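/- Let $F$ be a field, and let $\mathrm{Zar}(F)$ be the set of valuation rings of $F$, that is, of subrings $V$ of $F$ such that for each nonzero $t \in F$, $t \in V$ or $t^{-1} \in V$. Write $\mathfrak{M}_V$ for the maximal ideal of $V \in \mathrm{Zar}(F)$. Equip $\mathrm{Zar}(F)$ with the patch topology, which has as a basis of open sets the sets $\{V \in \mathrm{Zar}(F) : x_1,\dots,x_n \in V,\ y_1,\dots,y_m \notin V\}$ with $n, m \ge 0$ and $x_i, y_j \in F$. For $X \subseteq \mathrm{Zar}(F)$ let $\lim(X)$ be the set of limit points of $X$ in this topology, and let $A(X) = \bigcap_{V \in X} V$ and $J(X) = \bigcap_{V \in X} \mathfrak{M}_V$. A domain $A$ is completely integrally closed if it contains every element $t$ of its quotient field for which there is $0 \neq a \in A$ with $a t^n \in A$ for all $n > 0$. Let $\emptyset \neq X \subseteq \mathrm{Zar}(F)$ with $J(X) \neq 0$, and suppose that $A(X)$ is a completely integrally closed local ring that is not a valuation ring of $F$. Then: 1. $A(X) = A(Y)$ for every co-countable subset $Y$ of $\lim(X)$, i.e. for every $Y \subseteq \lim(X)$ such that $\lim(X) \setminus Y$ is countable (finite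 or countably infinite). 2. Hence $\lim(X)$ is uncountable. 3. Hence also, if $Z$ is any set of valuation rings of $F$ that dominate $A(X)$ (i.e. contain $A(X)$ and have a maximal ideal that contains the maximal ideal of $A(X)$) and $A(X) = A(Z)$, then $\lim(Z)$ is uncountable; in particular, $A(X)$ is not the intersection of a countable patch-closed set of valuation rings that dominate it. -/

import Mathlib

/-- The basis of the patch (constructible) topology on the set `Zar(F)` of valuation rings of `F`:
the sets of valuation rings that contain each of finitely many given elements of `F`
and omit each of finitely many given elements of `F`. -/
def patchBasis (F : Type*) [Field F] : Set (Set (ValuationSubring F)) :=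
  {B | ∃ s t : Finset F, B = {V : ValuationSubring F | (∀ x ∈ s, x ∈ V) ∧ (∀ y ∈ t, y ∉ V)}}

/-- The patch topology on the set of valuation rings of `F`. -/
@[reducible]
def patchTopology (F : Type*) [Field F] : TopologicalSpace (ValuationSubring F) :=
  TopologicalSpace.generateFrom (patchBasis F)

/-- `lim(X)`: the set of limit (accumulation) points of `X` in the patch topology. -/
def patchLim {F : Type*} [Field F] (X : Set (ValuationSubring F)) : Set (ValuationSubring F) :=
  @derivedSet _ (patchTopology F) X

/-- `A(X)`: the intersection of the valuation rings in `X`, a subring of `F`. -/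
def intersectionRing {F : Type*} [Field F] (X : Set (ValuationSubring F)) : Subring F :=
  ⨅ V ∈ X, V.toSubring

/-- `J(X)`: the intersection of the maximal ideals of the valuation rings in `X`,
each viewed as a subset of `F`. -/
def intersectionRadical {F : Type*} [Field F] (X : Set (ValuationSubring F)) :
    NonUnitalSubring F :=
  ⨅ V ∈ X, V.nonunits

/-- A domain is completely integrally closed if it contains every element of its quotient field
that is almost integral over it. -/
def IsCompletelyIntegrallyClosed (A : Type*) [CommRing A] [IsDomain A] : Prop :=
  ∀ t : FractionRing A, IsAlmostIntegral A t → t ∈ (algebraMap A (FractionRing A)).range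

section

open Set Filter Topology

variable {F : Type*} [Field F]

/-! Passing to the patch closure of X changes neither A(X) nor which nonzero elements lie in J(X).
The patch topology is compact Hausdorff, so Zorn's lemma gives a minimal patch-closed C in that
closure with A(C) = A(X). By `intersectionRing_diff_singleton` an isolated point of C could be
dropped, so C is perfect and lies in lim(X). If t is not in A(X), the members of C omitting t form a
nonempty relatively open set, uncountable by Baire, so every co-countable Y in lim(X) contains one
of them. Taking Y empty gives uncountability; domination lets Z replace X. -/

theorem mem_intersectionRing {X : Set (ValuationSubring F)} {t : F} :
    t ∈ intersectionRing X ↔ ∀ V ∈ X, t ∈ V := by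
  simp [intersectionRing, Subring.mem_iInf]

theorem mem_intersectionRadical {X : Set (ValuationSubring F)} {t : F} :
    t ∈ intersectionRadical X ↔ ∀ V ∈ X, t ∈ V.nonunits := by
  simp [intersectionRadical, NonUnitalSubring.mem_iInf]

theorem intersectionRing_anti {X Y : Set (ValuationSubring F)} (h : X ⊆ Y) :
    intersectionRing Y ≤ intersectionRing X := fun _ ht =>
  mem_intersectionRing.2 fun V hV => mem_intersectionRing.1 ht V (h hV)

theorem intersectionRing_empty : intersectionRing (∅ : Set (ValuationSubring F)) = ⊤ := by
  simp [intersectionRing]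

theorem intersectionRing_singleton (V : ValuationSubring F) :
    intersectionRing {V} = V.toSubring := by
  simp [intersectionRing]

/-- Complete integral closedness of a subring of a field, tested in the ambient field. -/
theorem IsCompletelyIntegrallyClosed.mem_of_forall_mul_pow_mem {A : Subring F}
    (hA : IsCompletelyIntegrallyClosed A) {a t : F} (ha : a ≠ 0) (h : ∀ n : ℕ, a * t ^ n ∈ A) :
    t ∈ A := by
  let φ : FractionRing A →+* F :=
    IsFractionRing.lift (K := FractionRing A) (g := A.subtype) Subtype.coe_injective
  have hφ (x : A) : φ (algebraMap A (FractionRing A) x) = x :=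
    IsFractionRing.lift_algebraMap (K := FractionRing A) (g := A.subtype)
      Subtype.coe_injective x
  have haA : a ∈ A := by simpa using h 0
  have hatA : a * t ∈ A := by simpa using h 1
  let t' : FractionRing A := algebraMap A _ ⟨a * t, hatA⟩ / algebraMap A _ ⟨a, haA⟩
  have ht' : φ t' = t := by
    simp only [t', map_div₀, hφ]
    field_simp
  have hint : IsAlmostIntegral A t' := by
    refine ⟨⟨a, haA⟩, mem_nonZeroDivisors_of_ne_zero fun h0 => ha (congrArg Subtype.val h0),
      fun n => ⟨⟨a * t ^ n, h n⟩, φ.injective ?_⟩⟩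
    rw [Algebra.smul_def, map_mul, map_pow, hφ, hφ, ht']
  obtain ⟨b, hb⟩ := hA t' hint
  have : (b : F) = t := by rw [← hφ b, ← ht']; exact congrArg φ hb
  exact this ▸ b.2

theorem Subring.inv_mem_of_isUnit {A : Subring F} {x : A} (hx : IsUnit x) : (x : F)⁻¹ ∈ A := by
  obtain ⟨y, hy⟩ := hx.exists_right_inv
  have hy' : (x : F) * y = 1 := congrArg Subtype.val hy
  rw [← eq_inv_of_mul_eq_one_right hy']
  exact y.2

/-! ### Removing one valuation ring from a representation -/

/-- No single valuation ring is needed in a representation of a completely integrally closed local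
ring, other than a valuation ring, by valuation rings with nonzero radical. -/
theorem intersectionRing_diff_singleton {C : Set (ValuationSubring F)} {j : F} (hj0 : j ≠ 0)
    (hj : j ∈ intersectionRadical C) (hcic : IsCompletelyIntegrallyClosed (intersectionRing C))
    (hlocal : IsLocalRing (intersectionRing C))
    (hval : ¬ ∃ V : ValuationSubring F, V.toSubring = intersectionRing C)
    (V : ValuationSubring F) : intersectionRing (C \ {V}) = intersectionRing C := by
  refine le_antisymm (fun t ht => ?_) (intersectionRing_anti sdiff_subset)
  by_contra htC
  rw [mem_intersectionRing] at ht
  rw [mem_intersectionRadical] at hj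
  -- Complete integral closedness produces u = j * t ^ n outside the ring; u lies in the maximal
  -- ideal of every member of C except V.
  obtain ⟨n, hn⟩ : ∃ n : ℕ, j * t ^ n ∉ intersectionRing C := by
    by_contra! h
    exact htC (hcic.mem_of_forall_mul_pow_mem hj0 h)
  set u := j * t ^ n
  have hu (W : ValuationSubring F) (hW : W ∈ C \ {V}) : W.valuation u < 1 := by
    rw [map_mul, map_pow]
    exact mul_lt_one_of_lt_of_le (hj W hW.1)
      (pow_le_one₀ zero_le ((W.valuation_le_one_iff t).2 (ht W hW)))
  have huV : V ∈ C ∧ u ∉ V := by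
    rw [mem_intersectionRing] at hn
    push Not at hn
    obtain ⟨W, hW, huW⟩ := hn
    have hWV : W = V := by
      by_contra hne
      exact huW (W.mem_of_valuation_le_one _ (hu W ⟨hW, hne⟩).le)
    exact hWV ▸ ⟨hW, huW⟩
  obtain ⟨W, hW⟩ : (C \ {V}).Nonempty := by
    by_contra! h
    refine hval ⟨V, ?_⟩
    rw [← intersectionRing_singleton,
      (sdiff_eq_empty.1 h).antisymm (singleton_subset_iff.2 huV.1)]
  have hone (W : ValuationSubring F) (hW : W ∈ C \ {V}) : W.valuation (1 + u) = 1 :=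
    Valuation.map_one_add_of_lt _ (hu W hW)
  have hVu : 1 < V.valuation u := by
    rw [← not_le, V.valuation_le_one_iff]; exact huV.2
  have hVone : V.valuation (1 + u) = V.valuation u :=
    V.valuation.map_add_eq_of_lt_right (x := 1) (y := u)
      (by rwa [map_one])
  have hne : 1 + u ≠ 0 := by
    intro h0
    have := hone W hW
    simp [h0] at this
  -- This element e is a nonunit at V, while 1 - e = u * e is a nonunit at W, so neither is a unit
  -- of the local ring.
  have he : (1 + u)⁻¹ ∈ intersectionRing C := by
    rw [mem_intersectionRing]
    intro W hW
    rw [← W.valuation_le_one_iff, map_inv₀]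
    by_cases hWV : W = V
    · rw [hWV, hVone]
      exact inv_le_one_of_one_le₀ hVu.le
    · rw [hone W ⟨hW, hWV⟩, inv_one]
  rcases IsLocalRing.isUnit_or_isUnit_one_sub_self (⟨(1 + u)⁻¹, he⟩ : intersectionRing C)
    with h | h
  · have h1 := mem_intersectionRing.1 (Subring.inv_mem_of_isUnit h) V huV.1
    rw [inv_inv, ← V.valuation_le_one_iff, hVone] at h1
    exact hVu.not_ge h1
  · have h1 := mem_intersectionRing.1 (Subring.inv_mem_of_isUnit h) W hW.1
    have h2 : (1 : F) - (1 + u)⁻¹ = u * (1 + u)⁻¹ := by field_simp; ring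
    have h3 : ((1 - ⟨(1 + u)⁻¹, he⟩ : intersectionRing C) : F) = u * (1 + u)⁻¹ := by
      rw [← h2]; rfl
    have hu0 : u ≠ 0 := fun h0 => huV.2 (h0 ▸ V.zero_mem)
    rw [h3, ← W.valuation_le_one_iff, map_inv₀, map_mul, map_inv₀, hone W hW, inv_one, mul_one,
      inv_le_one₀ ((Valuation.pos_iff _).2 hu0)] at h1
    exact (hu W hW).not_ge h1

-- The patch topology

attribute [local instance] patchTopology

theorem isOpen_setOf_mem (x : F) : IsOpen {V : ValuationSubring F | x ∈ V} :=
  TopologicalSpace.isOpen_generateFrom_of_mem ⟨{x}, ∅, by simp⟩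

theorem isOpen_setOf_notMem (x : F) : IsOpen {V : ValuationSubring F | x ∉ V} :=
  TopologicalSpace.isOpen_generateFrom_of_mem ⟨∅, {x}, by simp⟩

theorem isClosed_setOf_mem (x : F) : IsClosed {V : ValuationSubring F | x ∈ V} :=
  ⟨isOpen_setOf_notMem x⟩

theorem isClosed_setOf_notMem (x : F) : IsClosed {V : ValuationSubring F | x ∉ V} := by
  simpa [← isOpen_compl_iff, compl_ofPred] using isOpen_setOf_mem x

theorem patchTopology_t2Space : T2Space (ValuationSubring F) where
  t2 := by
    have key (V W : ValuationSubring F) (x : F) (hV : x ∈ V) (hW : x ∉ W) :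
        ∃ u v : Set (ValuationSubring F), IsOpen u ∧ IsOpen v ∧ V ∈ u ∧ W ∈ v ∧ Disjoint u v :=
      ⟨_, _, isOpen_setOf_mem x, isOpen_setOf_notMem x, hV, hW, disjoint_compl_right⟩
    intro V W hne
    obtain ⟨x, hx⟩ : ∃ x, ¬ (x ∈ V ↔ x ∈ W) := by
      by_contra! h
      exact hne (SetLike.ext h)
    by_cases hV : x ∈ V
    · exact key V W x hV fun hW => hx ⟨fun _ => hW, fun _ => hV⟩
    · obtain ⟨u, v, hu, hv, h1, h2, h3⟩ :=
        key W V x (by by_contra hW; exact hx ⟨fun h => (hV h).elim, fun h => (hW h).elim⟩) hV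
      exact ⟨v, u, hv, hu, h2, h1, h3.symm⟩

/-- An ultrafilter converges to the ring of elements that lie in almost every W. -/
theorem patchTopology_compactSpace : CompactSpace (ValuationSubring F) where
  isCompact_univ := by
    rw [isCompact_iff_ultrafilter_le_nhds]
    intro G _
    let V : ValuationSubring F :=
      { carrier := {x | ∀ᶠ W : ValuationSubring F in G, x ∈ W}
        mul_mem' := fun ha hb => by
          filter_upwards [ha, hb] with W h1 h2 using W.mul_mem _ _ h1 h2
        one_mem' := Eventually.of_forall fun W => W.one_mem
        add_mem' := fun ha hb => by
          filter_upwards [ha, hb] with W h1 h2 using W.add_mem _ _ h1 h2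
        zero_mem' := Eventually.of_forall fun W => W.zero_mem
        neg_mem' := fun ha => by
          filter_upwards [ha] with W h1 using W.neg_mem _ h1
        mem_or_inv_mem' := fun x => Ultrafilter.eventually_or.1
          (Eventually.of_forall fun W => W.mem_or_inv_mem x) }
    have hV (x : F) : x ∈ V ↔ ∀ᶠ W : ValuationSubring F in G, x ∈ W := Iff.rfl
    refine ⟨V, mem_univ _, ?_⟩
    rw [TopologicalSpace.nhds_generateFrom]
    refine le_iInf₂ fun B hB => le_principal_iff.2 ?_
    obtain ⟨hVB, s, t, rfl⟩ := hB
    have h1 : ∀ᶠ W : ValuationSubring F in G, ∀ x ∈ s, x ∈ W :=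
      (Finset.eventually_all s).2 fun x hx => (hV x).1 (hVB.1 x hx)
    have h2 : ∀ᶠ W : ValuationSubring F in G, ∀ x ∈ t, x ∉ W :=
      (Finset.eventually_all t).2 fun x hx =>
        Ultrafilter.eventually_not.2 fun h => hVB.2 x hx ((hV x).2 h)
    filter_upwards [h1, h2] with W h3 h4 using ⟨h3, h4⟩

/-- A nonempty relatively open subset of a perfect set in a compact Hausdorff space is
uncountable. -/
theorem Perfect.not_countable_inter {α : Type*} [TopologicalSpace α] [CompactSpace α] [T2Space α]
    {C U : Set α} (hC : Perfect C) (hU : IsOpen U) (hne : (C ∩ U).Nonempty) :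
    ¬ (C ∩ U).Countable := by
  intro hcount
  have : CompactSpace C := isCompact_iff_compactSpace.1 hC.closed.isCompact
  have hd (x : C) : Dense ({x}ᶜ : Set C) := by
    rw [dense_compl_singleton_iff_not_open]
    intro ho
    obtain ⟨O, hO, hOx⟩ := isOpen_induced_iff.1 ho
    have hxO : (x : α) ∈ O := by
      have : x ∈ (Subtype.val ⁻¹' O : Set C) := hOx ▸ mem_singleton x
      exact this
    obtain ⟨y, hy, hyx⟩ := preperfect_iff_nhds.1 hC.acc x x.2 O (hO.mem_nhds hxO)
    have : (⟨y, hy.2⟩ : C) ∈ ({x} : Set C) := hOx ▸ hy.1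
    exact hyx (congrArg Subtype.val this)
  have hS : (Subtype.val ⁻¹' U : Set C).Countable :=
    (hcount.preimage (Subtype.val_injective (p := (· ∈ C)))).mono
      fun (x : C) (hx : (x : α) ∈ U) => (⟨x.2, hx⟩ : (x : α) ∈ C ∩ U)
  -- By Baire, deleting the countably many points of U from C leaves a dense set, which must still
  -- meet U.
  have hdense := dense_biInter_of_isOpen (S := (Subtype.val ⁻¹' U : Set C))
    (f := fun x => {x}ᶜ) (fun x _ => isOpen_compl_singleton) hS fun x _ => hd x
  obtain ⟨x, hxC, hxU⟩ := hne
  obtain ⟨y, hyU, hy⟩ := hdense.inter_open_nonempty _ (hU.preimage continuous_subtype_val)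
    ⟨⟨x, hxC⟩, hxU⟩
  exact mem_iInter₂.1 hy y hyU rfl

/-! ### Minimal closed representations -/

theorem intersectionRing_closure (X : Set (ValuationSubring F)) :
    intersectionRing (closure X) = intersectionRing X := by
  refine le_antisymm (intersectionRing_anti subset_closure) fun t ht => ?_
  exact mem_intersectionRing.2 fun V hV =>
    closure_minimal (fun W hW => mem_intersectionRing.1 ht W hW) (isClosed_setOf_mem t) hV

/-- For j ≠ 0, lying in the maximal ideal of V means j⁻¹ ∉ V, a patch-closed condition. -/
theorem mem_intersectionRadical_closure {X : Set (ValuationSubring F)} {j : F} (hj0 : j ≠ 0)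
    (hj : j ∈ intersectionRadical X) : j ∈ intersectionRadical (closure X) := by
  simp only [mem_intersectionRadical, ValuationSubring.mem_nonunits_iff_or, hj0, false_or]
    at hj ⊢
  exact fun V hV => closure_minimal (t := {V : ValuationSubring F | j⁻¹ ∉ V})
    (fun W hW => hj W hW) (isClosed_setOf_notMem _) hV

/-- Among the patch-closed subsets of a patch-closed set that have the same intersection,
there is a minimal one. -/
theorem exists_minimal_isClosed_intersectionRing_eq {X : Set (ValuationSubring F)}
    (hX : IsClosed X) :
    ∃ C ⊆ X, Minimal (· ∈ {C | IsClosed C ∧ intersectionRing C ≤ intersectionRing X}) C := by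
  have := patchTopology_compactSpace (F := F)
  refine zorn_superset_nonempty _ (fun c hc hchain hcne => ?_) X ⟨hX, le_rfl⟩
  refine ⟨⋂₀ c, ⟨isClosed_sInter fun D hD => (hc hD).1, fun t ht => ?_⟩,
    fun D hD => sInter_subset_of_mem hD⟩
  by_contra htX
  have : Nonempty c := hcne.to_subtype
  -- Every D in the chain has a member omitting t; compactness yields a common one.
  have hcl (D : c) : IsClosed ((D : Set (ValuationSubring F)) ∩ {V | t ∉ V}) :=
    (hc D.2).1.inter (isClosed_setOf_notMem t)
  obtain ⟨V, hV⟩ := IsCompact.nonempty_iInter_of_directed_nonempty_isCompact_isClosed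
    (fun D : c => (D : Set (ValuationSubring F)) ∩ {V | t ∉ V})
    (fun D E => by
      rcases hchain.total D.2 E.2 with h | h
      · exact ⟨D, subset_rfl, inter_subset_inter_left _ h⟩
      · exact ⟨E, inter_subset_inter_left _ h, subset_rfl⟩)
    (fun D => by
      by_contra! h
      refine htX ((hc D.2).2 (mem_intersectionRing.2 fun V hV => ?_))
      by_contra htV
      exact eq_empty_iff_forall_notMem.1 h V ⟨hV, htV⟩)
    (fun D => (hcl D).isCompact) hcl
  rw [mem_iInter] at hV
  exact (hV (Classical.arbitrary c)).2
    (mem_intersectionRing.1 ht V (mem_sInter.2 fun D hD => (hV ⟨D, hD⟩).1))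

/-- A completely integrally closed local ring, other than a valuation ring, that is represented by
valuation rings with nonzero radical is represented by a perfect set of limit points of them. -/
theorem exists_perfect_subset_patchLim {X : Set (ValuationSubring F)} {j : F} (hj0 : j ≠ 0)
    (hj : j ∈ intersectionRadical X) (hcic : IsCompletelyIntegrallyClosed (intersectionRing X))
    (hlocal : IsLocalRing (intersectionRing X))
    (hval : ¬ ∃ V : ValuationSubring F, V.toSubring = intersectionRing X) :
    ∃ C ⊆ patchLim X, Perfect C ∧ intersectionRing C = intersectionRing X := by
  have := patchTopology_t2Space (F := F)
  obtain ⟨C, hCX, hC⟩ := exists_minimal_isClosed_intersectionRing_eq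
    (isClosed_closure (s := X))
  have hCA : intersectionRing C = intersectionRing X :=
    (hC.prop.2.trans_eq (intersectionRing_closure X)).antisymm
      (intersectionRing_closure X ▸ intersectionRing_anti hCX)
  have hjC : j ∈ intersectionRadical C := mem_intersectionRadical.2 fun V hV =>
    mem_intersectionRadical.1 (mem_intersectionRadical_closure hj0 hj) V (hCX hV)
  have hacc : Preperfect C := by
    rw [preperfect_iff_nhds]
    intro V hV U hU
    by_contra! h
    have hclosed : IsClosed (C \ {V}) := by
      have : C \ {V} = C ∩ (interior U)ᶜ := by
        ext W
        constructor
        · exact fun hW => ⟨hW.1, fun hWU => hW.2 (h W ⟨interior_subset hWU, hW.1⟩)⟩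
        · rintro ⟨hW, hWU⟩
          exact ⟨hW, fun hWV => hWU (hWV ▸ mem_interior_iff_mem_nhds.2 hU)⟩
      rw [this]
      exact hC.prop.1.inter isOpen_interior.isClosed_compl
    have hA : intersectionRing (C \ {V}) = intersectionRing C :=
      intersectionRing_diff_singleton hj0 hjC (hCA ▸ hcic) (hCA ▸ hlocal) (hCA ▸ hval) V
    exact (hC.le_of_le ⟨hclosed, hA ▸ hC.prop.2⟩ sdiff_subset hV).2 rfl
  refine ⟨C, fun V hV => ?_, ⟨hC.prop.1, hacc⟩, hCA⟩
  have : V ∈ derivedSet (closure X) := derivedSet_mono _ _ hCX (hacc V hV)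
  rwa [derivedSet_closure] at this

theorem intersectionRing_eq_of_countable_patchLim_diff {X Y : Set (ValuationSubring F)} {j : F}
    (hj0 : j ≠ 0) (hj : j ∈ intersectionRadical X)
    (hcic : IsCompletelyIntegrallyClosed (intersectionRing X))
    (hlocal : IsLocalRing (intersectionRing X))
    (hval : ¬ ∃ V : ValuationSubring F, V.toSubring = intersectionRing X)
    (hY : Y ⊆ patchLim X) (hcount : (patchLim X \ Y).Countable) :
    intersectionRing X = intersectionRing Y := by
  have := patchTopology_t2Space (F := F)
  have := patchTopology_compactSpace (F := F)
  refine le_antisymm ?_ fun t ht => ?_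
  · rw [← intersectionRing_closure X]
    exact intersectionRing_anti (hY.trans (derivedSet_subset_closure X))
  · obtain ⟨C, hCX, hC, hCA⟩ := exists_perfect_subset_patchLim hj0 hj hcic hlocal hval
    by_contra htX
    rw [← hCA, mem_intersectionRing] at htX
    push Not at htX
    obtain ⟨V, hV, htV⟩ := htX
    refine hC.not_countable_inter (isOpen_setOf_notMem t) ⟨V, hV, htV⟩ (hcount.mono ?_)
    exact fun W hW => ⟨hCX hW.1, fun hWY => hW.2 (mem_intersectionRing.1 ht W hWY)⟩

/-- Otherwise Y = ∅ would be co-countable, making the ring equal to F, a valuation ring. -/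
theorem not_countable_patchLim {X : Set (ValuationSubring F)} {j : F} (hj0 : j ≠ 0)
    (hj : j ∈ intersectionRadical X) (hcic : IsCompletelyIntegrallyClosed (intersectionRing X))
    (hlocal : IsLocalRing (intersectionRing X))
    (hval : ¬ ∃ V : ValuationSubring F, V.toSubring = intersectionRing X) :
    ¬ (patchLim X).Countable := fun hcount => hval ⟨⊤, by
  rw [intersectionRing_eq_of_countable_patchLim_diff hj0 hj hcic hlocal hval (empty_subset _)
    (by simpa using hcount), intersectionRing_empty, ValuationSubring.toSubring_top]⟩

/-- Nonzero elements of the radical of a nonempty `X` lie in the maximal ideal of every valuation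
ring that dominates the intersection of `X`. -/
theorem mem_nonunits_of_le_toLocalSubring {X : Set (ValuationSubring F)} (hX : X.Nonempty) {j : F}
    (hj0 : j ≠ 0) (hj : j ∈ intersectionRadical X) [IsLocalRing (intersectionRing X)]
    {V : ValuationSubring F} (hV : LocalSubring.mk (intersectionRing X) ≤ V.toLocalSubring) :
    j ∈ V.nonunits := by
  obtain ⟨hle, hloc⟩ := LocalSubring.le_def.1 hV
  rw [mem_intersectionRadical] at hj
  have hjA : j ∈ intersectionRing X :=
    mem_intersectionRing.2 fun W hW => ValuationSubring.nonunits_subset (hj W hW)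
  rw [ValuationSubring.mem_nonunits_iff_or]
  refine Or.inr fun hinv => ?_
  -- If j were a unit of V, domination would make it a unit of A(X), hence of every W in X.
  have hunit : IsUnit (Subring.inclusion hle ⟨j, hjA⟩) :=
    IsUnit.of_mul_eq_one (⟨j⁻¹, hinv⟩ : V.toSubring) (Subtype.ext (mul_inv_cancel₀ hj0))
  obtain ⟨W, hW⟩ := hX
  have := Subring.inv_mem_of_isUnit (hloc.map_nonunit _ hunit)
  exact (W.mem_nonunits_iff_or.1 (hj W hW)).elim hj0
    fun h => h (mem_intersectionRing.1 this W hW)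

end

theorem corollary3p7 {F : Type*} [Field F] (X : Set (ValuationSubring F))
    (hX : X.Nonempty)
    (hJ : intersectionRadical X ≠ ⊥)
    (hcic : IsCompletelyIntegrallyClosed (intersectionRing X))
    (hlocal : IsLocalRing (intersectionRing X))
    (hval : ¬ ∃ V : ValuationSubring F, V.toSubring = intersectionRing X) :
    (∀ Y : Set (ValuationSubring F), Y ⊆ patchLim X → (patchLim X \ Y).Countable →
      intersectionRing X = intersectionRing Y) ∧
    ¬ (patchLim X).Countable ∧
    (∀ Z : Set (ValuationSubring F),
      (∀ V ∈ Z, LocalSubring.mk (intersectionRing X) ≤ V.toLocalSubring) →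
      intersectionRing Z = intersectionRing X →
      ¬ (patchLim Z).Countable) := by
  obtain ⟨j, hj, hj0⟩ : ∃ j ∈ intersectionRadical X, j ≠ 0 := by
    by_contra! h
    exact hJ (eq_bot_iff.2 fun x hx => (h x hx).symm ▸ zero_mem _)
  refine ⟨fun Y hY hcount => intersectionRing_eq_of_countable_patchLim_diff hj0 hj hcic hlocal
    hval hY hcount, not_countable_patchLim hj0 hj hcic hlocal hval, fun Z hZ hZA => ?_⟩
  have hjZ : j ∈ intersectionRadical Z := mem_intersectionRadical.2 fun V hV =>
    mem_nonunits_of_le_toLocalSubring hX hj0 hj (hZ V hV)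
  exact not_countable_patchLim hj0 hjZ (hZA ▸ hcic) (hZA ▸ hlocal) (hZA ▸ hval)
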